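/- Let $F$ be a semifield, i.e. a commutative semiring in which $0 \neq 1$ and every nonzero element has a multiplicative inverse (subtraction is not assumed). A (unital, associative) $F$-algebra is called matricial if it is isomorphic to $M_{n_1}(F) \times \cdots \times M_{n_r}(F)$ for some $r \ge 0$ and positive integers $n_1, \dots, n_r$, and ultramatricial if it is isomorphic to the direct limit, in the category of unital $F$-algebras, of a sequence $S_1 \to S_2 \to \cdots$ of matricial $F$-algebras. For a semiring $S$, a right $S$-semimodule is projective if it is a retract of a free right $S$-semimodule; let $\mathcal{V}(S)$ be the commutative monoid of isomorphism classes $\overline{P}$ of finitely generated projective right $S$-semimodules $P$, with addition $\overline{P} + \overline{Q} = \overline{P \oplus Q}$ and zero element $\overline{0}$, and let $\overline{S} \in \mathcal{V}(S)$ be the class of the regular right semimodule $S_S$. Theorem. Let $S$ and $T$ be ultramatricial algebras over a semifield $F$. Then there exists a monoid isomorphism $f \colon \mathcal{V}(S) \to \mathcal{V}(T)$ with $f(\overline{S}) = \overline{T}$ if and only if $S \cong T$ as $F$-algebras. -/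

import Mathlib

universe u v

/-- A matricial `F`-algebra: an `F`-algebra isomorphic to a finite direct product
`M_{n₁}(F) × ⋯ × M_{nᵣ}(F)` with all `nᵢ` positive (for `r = 0` this is the zero algebra). -/
def IsMatricial (F : Type u) [Semifield F] (A : Type v) [Semiring A] [Algebra F A] : Prop :=
  ∃ (r : ℕ) (n : Fin r → ℕ), (∀ i, 0 < n i) ∧
    Nonempty (A ≃ₐ[F] ((i : Fin r) → Matrix (Fin (n i)) (Fin (n i)) F))

/-- An ultramatricial `F`-algebra: a unital `F`-algebra isomorphic to the direct limit of a sequence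
`A 0 → A 1 → A 2 → ⋯` of matricial `F`-algebras and unital `F`-algebra homomorphisms.
The stages are taken in the universe of `F`, which is no restriction, since every matricial
`F`-algebra is isomorphic to one there. -/
def IsUltramatricial (F : Type u) [Semifield F] (S : Type v) [Semiring S] [Algebra F S] : Prop :=
  ∃ (A : ℕ → Type u) (_ : ∀ i, Semiring (A i)) (_ : ∀ i, Algebra F (A i))
    (f : ∀ i j : ℕ, i ≤ j → A i →ₐ[F] A j) (_ : DirectedSystem A (f · · ·)),
    (∀ i, IsMatricial F (A i)) ∧ Nonempty (S ≃ₐ[F] DirectLimit A f)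

/-- Finitely generated projective right semimodules over a semiring `S`. Right `S`-semimodules are
`Sᵐᵒᵖ`-modules; no subtraction is assumed. Every finitely generated right `S`-semimodule is
isomorphic to one in the universe of `S`. -/
structure FGProjRight (S : Type v) [Semiring S] where
  carrier : Type v
  [addCommMonoid : AddCommMonoid carrier]
  [module : Module Sᵐᵒᵖ carrier]
  [finite : Module.Finite Sᵐᵒᵖ carrier]
  [projective : Module.Projective Sᵐᵒᵖ carrier]

namespace FGProjRight

attribute [instance] addCommMonoid module finite projective

variable (S : Type v) [Semiring S]

/-- The regular right semimodule `S_S` is isomorphic to the free `Sᵐᵒᵖ`-module of rank one. -/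
def opEquiv : Sᵐᵒᵖ ≃ₗ[Sᵐᵒᵖ] S where
  toFun := MulOpposite.unop
  invFun := MulOpposite.op
  left_inv _ := rfl
  right_inv _ := rfl
  map_add' _ _ := rfl
  map_smul' _ _ := rfl

/-- The regular right semimodule `S_S`, with `op s` acting as right multiplication by `s`. -/
def regular : FGProjRight S where
  carrier := S
  finite := Module.Finite.equiv (opEquiv S)
  projective := Module.Projective.of_equiv' (opEquiv S)

/-- Two right semimodules are equivalent when they are isomorphic. -/
instance isoSetoid : Setoid (FGProjRight S) where
  r P Q := Nonempty (P.carrier ≃ₗ[Sᵐᵒᵖ] Q.carrier)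
  iseqv :=
    ⟨fun _ => ⟨LinearEquiv.refl _ _⟩, fun ⟨e⟩ => ⟨e.symm⟩, fun ⟨e⟩ ⟨e'⟩ => ⟨e.trans e'⟩⟩

end FGProjRight

/-- `V(S)`: the isomorphism classes of finitely generated projective right `S`-semimodules. -/
def VMonoid (S : Type v) [Semiring S] : Type (v + 1) :=
  Quotient (FGProjRight.isoSetoid S)

namespace VMonoid

variable {S : Type v} [Semiring S]

/-- The isomorphism class of a finitely generated projective right semimodule. -/
def mk (P : FGProjRight S) : VMonoid S := Quotient.mk (FGProjRight.isoSetoid S) P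

/-- Addition of isomorphism classes is induced by the direct sum of semimodules. -/
instance : Add (VMonoid S) where
  add := Quotient.map₂ (fun P Q => ⟨P.carrier × Q.carrier⟩)
    (fun _ _ ⟨e⟩ _ _ ⟨e'⟩ => ⟨e.prodCongr e'⟩)

/-- The class of the zero semimodule. -/
instance : Zero (VMonoid S) where
  zero := mk ⟨PUnit⟩

instance : AddCommMonoid (VMonoid S) where
  add_assoc := by
    rintro ⟨P⟩ ⟨Q⟩ ⟨R⟩
    exact Quotient.sound ⟨LinearEquiv.prodAssoc Sᵐᵒᵖ P.carrier Q.carrier R.carrier⟩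
  zero_add := by
    rintro ⟨P⟩
    exact Quotient.sound ⟨LinearEquiv.uniqueProd⟩
  add_zero := by
    rintro ⟨P⟩
    exact Quotient.sound ⟨LinearEquiv.prodUnique⟩
  add_comm := by
    rintro ⟨P⟩ ⟨Q⟩
    exact Quotient.sound ⟨LinearEquiv.prodComm Sᵐᵒᵖ P.carrier Q.carrier⟩
  nsmul := nsmulRec

end VMonoid

/-! This is Elliott's classification by a back-and-forth argument, with subtraction avoided. Classes
are handled through idempotents of `S`: two idempotents lie in the same class exactly when they are
Murray–von Neumann equivalent, and a decomposition of the class of `p` as a finite sum lifts to an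
orthogonal decomposition of `p`. Hence unital maps from a matricial algebra to `S` come from
decompositions of the class of `S` (`VMonoid.exists_algHom`) and are determined up to conjugation by
the classes of the minimal idempotents (`MatAlg.exists_conj`).

Idempotent matrices over a semifield can be wild, but only complemented ones occur, since a unital
map sends `p + q = 1`, `p * q = 0` to the same relations. A complemented idempotent is equivalent to
a sum of diagonal matrix units (`MatAlg.exists_mvNEquiv`): either `F` is a field, or `F` is
zerosumfree and the idempotent is itself diagonal. So `f` transports a map into `S` to one into `T`,
compatibly with maps already chosen (`MatAlg.Linked.exists_extension`). Alternating between `S` and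
`T` gives an increasing chain of subalgebras of `S × T` whose union is the graph of an isomorphism.
-/

/-- Murray–von Neumann equivalence of elements of a monoid. -/
def MvNEquiv {S : Type*} [Mul S] (p q : S) : Prop := ∃ u v : S, u * v = p ∧ v * u = q

namespace MvNEquiv

theorem symm {S : Type*} [Mul S] {p q : S} : MvNEquiv p q → MvNEquiv q p :=
  fun ⟨u, v, h, h'⟩ => ⟨v, u, h', h⟩

theorem map {S T G : Type*} [Mul S] [Mul T] [FunLike G S T] [MulHomClass G S T] (g : G) {p q : S} :
    MvNEquiv p q → MvNEquiv (g p) (g q) := by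
  rintro ⟨u, v, rfl, rfl⟩
  exact ⟨g u, g v, (map_mul ..).symm, (map_mul ..).symm⟩

end MvNEquiv

/-! ### Classes in `V(S)` represented by idempotents of `S` -/

namespace VMonoid

variable {S : Type v} [Semiring S]

/-- The element `p` of `S` represents the class `x`: the module `pS` is a retract of `S` along `p`
and lies in `x`. -/
def IsClassOf (p : S) (x : VMonoid S) : Prop :=
  ∃ (P : FGProjRight S) (i : P.carrier →ₗ[Sᵐᵒᵖ] S) (s : S →ₗ[Sᵐᵒᵖ] P.carrier),
    mk P = x ∧ (∀ a, s (i a) = a) ∧ ∀ b, i (s b) = p * b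

theorem apply_mul {M : Type*} [AddCommMonoid M] [Module Sᵐᵒᵖ M] (g : S →ₗ[Sᵐᵒᵖ] M) (a b : S) :
    g (a * b) = MulOpposite.op b • g a := by
  rw [← map_smul, MulOpposite.smul_eq_mul_unop, MulOpposite.unop_op]

theorem apply_eq_mul (g : S →ₗ[Sᵐᵒᵖ] S) (b : S) : g b = g 1 * b := by
  conv_lhs => rw [← one_mul b, apply_mul]
  rw [MulOpposite.smul_eq_mul_unop, MulOpposite.unop_op]

theorem mk_eq_iff {P Q : FGProjRight S} :
    mk P = mk Q ↔ Nonempty (P.carrier ≃ₗ[Sᵐᵒᵖ] Q.carrier) :=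
  Quotient.eq (r := FGProjRight.isoSetoid S)

/-- Left multiplication as a map of right semimodules. -/
def leftMul (a : S) : S →ₗ[Sᵐᵒᵖ] S where
  toFun b := a * b
  map_add' := mul_add a
  map_smul' r b := by simp [MulOpposite.smul_eq_mul_unop, mul_assoc]

@[simp] theorem leftMul_apply (a b : S) : leftMul a b = a * b := rfl

namespace IsClassOf

variable {p q : S} {x y : VMonoid S}

theorem isIdempotentElem (h : IsClassOf p x) : p * p = p := by
  obtain ⟨P, i, s, -, h1, h2⟩ := h
  have := h2 (p * 1)
  rwa [← h2 1, h1, h2, mul_one, eq_comm] at this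

theorem one : IsClassOf (1 : S) (mk (FGProjRight.regular S)) :=
  ⟨FGProjRight.regular S, LinearMap.id, LinearMap.id, rfl, fun _ => rfl, fun b => (one_mul b).symm⟩

theorem eq_of_eq (h : IsClassOf p x) (h' : IsClassOf p y) : x = y := by
  obtain ⟨P, i, s, rfl, h1, h2⟩ := h
  obtain ⟨Q, j, t, rfl, k1, k2⟩ := h'
  refine mk_eq_iff.2 ⟨LinearEquiv.ofLinearMap (t ∘ₗ i) (s ∘ₗ j) ?_ ?_⟩
  · ext a; simp only [LinearMap.comp_apply, LinearMap.id_apply]; rw [h2, ← k2, k1, k1]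
  · ext a; simp only [LinearMap.comp_apply, LinearMap.id_apply]; rw [k2, ← h2, h1, h1]

theorem mvNEquiv (h : IsClassOf p x) (h' : IsClassOf q x) : MvNEquiv p q := by
  obtain ⟨P, i, s, rfl, h1, h2⟩ := h
  obtain ⟨Q, j, t, hQ, k1, k2⟩ := h'
  obtain ⟨θ⟩ := mk_eq_iff.1 hQ
  refine ⟨(i ∘ₗ θ.toLinearMap ∘ₗ t) 1, (j ∘ₗ θ.symm.toLinearMap ∘ₗ s) 1, ?_, ?_⟩
  · rw [← apply_eq_mul]; simp [k1, h2]
  · rw [← apply_eq_mul]; simp [k2, h1]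

/-- Idempotency of `q` has to be assumed: `u * v` may be idempotent without `v * u` being so, for
instance when `u * v = 0`. -/
theorem of_mvNEquiv (h : IsClassOf p x) (hq : q * q = q) (hpq : MvNEquiv p q) :
    IsClassOf q x := by
  obtain ⟨P, i, s, rfl, h1, h2⟩ := h
  obtain ⟨u, v, rfl, rfl⟩ := hpq
  refine ⟨P, leftMul v ∘ₗ i, s ∘ₗ leftMul u, rfl, fun a => ?_, fun b => ?_⟩
  · simp only [LinearMap.comp_apply, leftMul_apply]
    rw [← mul_assoc, ← h2, h1, h1]
  · simp only [LinearMap.comp_apply, leftMul_apply]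
    rw [h2, ← hq]; simp only [mul_assoc]

theorem add (h : IsClassOf p x) (h' : IsClassOf q y) (hpq : p * q = 0) (hqp : q * p = 0) :
    IsClassOf (p + q) (x + y) := by
  obtain ⟨P, i, s, rfl, h1, h2⟩ := h
  obtain ⟨Q, j, t, rfl, k1, k2⟩ := h'
  have e1 (b) : s (j b) = 0 := by
    rw [← h1 (s (j b)), ← k1 b, k2, h2, ← mul_assoc, hpq, zero_mul, map_zero]
  have e2 (b) : t (i b) = 0 := by
    rw [← k1 (t (i b)), ← h1 b, h2, k2, ← mul_assoc, hqp, zero_mul, map_zero]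
  refine ⟨⟨P.carrier × Q.carrier⟩, i.coprod j, s.prod t, rfl, fun ⟨a, b⟩ => ?_, fun b => ?_⟩
  · simp [h1, k1, e1, e2]
  · simp [h2, k2, add_mul]

theorem zero : IsClassOf (0 : S) 0 :=
  ⟨⟨PUnit⟩, 0, 0, rfl, fun _ => rfl, fun b => by simp⟩

theorem eq_zero (h : IsClassOf p 0) : p = 0 := by
  obtain ⟨u, v, huv, hvu⟩ := h.mvNEquiv zero
  rw [← h.isIdempotentElem, ← huv]
  calc u * v * (u * v) = u * (v * u) * v := by simp only [mul_assoc]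
    _ = 0 := by rw [hvu]; simp

theorem exists_of_isIdempotentElem (hp : p * p = p) : ∃ x, IsClassOf p x := by
  let i := (LinearMap.range (leftMul p)).subtype
  let s := (leftMul p).rangeRestrict
  have hs : ∀ a, s (i a) = a := by
    rintro ⟨_, b, rfl⟩
    exact Subtype.ext (by simp [i, s, ← mul_assoc, hp])
  have : Module.Finite Sᵐᵒᵖ S := Module.Finite.equiv (FGProjRight.opEquiv S)
  have : Module.Projective Sᵐᵒᵖ S := Module.Projective.of_equiv' (FGProjRight.opEquiv S)
  have : Module.Finite Sᵐᵒᵖ (LinearMap.range (leftMul p)) :=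
    Module.Finite.of_surjective s (fun a => ⟨i a, hs a⟩)
  have : Module.Projective Sᵐᵒᵖ (LinearMap.range (leftMul p)) :=
    Module.Projective.of_split i s (LinearMap.ext hs)
  exact ⟨_, ⟨LinearMap.range (leftMul p)⟩, i, s, rfl, hs, fun b => rfl⟩

theorem sum {ι : Type*} (A : Finset ι) {p : ι → S} {x : ι → VMonoid S}
    (h : ∀ a ∈ A, IsClassOf (p a) (x a))
    (hp : ∀ a ∈ A, ∀ b ∈ A, a ≠ b → p a * p b = 0) :
    IsClassOf (∑ a ∈ A, p a) (∑ a ∈ A, x a) := by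
  classical
  induction A using Finset.induction_on with
  | empty => simpa using zero
  | insert a A ha ih =>
    rw [Finset.sum_insert ha, Finset.sum_insert ha]
    have hne : ∀ b ∈ A, a ≠ b := fun b hb hab => ha (hab ▸ hb)
    refine (h a (by simp)).add (ih (fun b hb => h b (by simp [hb]))
      fun b hb c hc => hp b (by simp [hb]) c (by simp [hc])) ?_ ?_
    · rw [Finset.mul_sum]
      exact Finset.sum_eq_zero fun b hb => hp a (by simp) b (by simp [hb]) (hne b hb)
    · rw [Finset.sum_mul]
      exact Finset.sum_eq_zero fun b hb => hp b (by simp [hb]) a (by simp) (hne b hb).symm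

/-- The two projections of `P ⊕ Q`, carried through `pS ≅ P ⊕ Q`, are endomorphisms of `S`, hence
left multiplications by orthogonal idempotents. -/
theorem exists_add (h : IsClassOf p (x + y)) :
    ∃ q r, q + r = p ∧ q * r = 0 ∧ r * q = 0 ∧ IsClassOf q x ∧ IsClassOf r y := by
  obtain ⟨R, i, s, hR, h1, h2⟩ := h
  obtain ⟨P, rfl⟩ := Quotient.exists_rep x
  obtain ⟨Q, rfl⟩ := Quotient.exists_rep y
  obtain ⟨θ⟩ : Nonempty (R.carrier ≃ₗ[Sᵐᵒᵖ] P.carrier × Q.carrier) :=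
    (mk_eq_iff (Q := ⟨P.carrier × Q.carrier⟩)).1 hR
  let iP : P.carrier →ₗ[Sᵐᵒᵖ] S := i ∘ₗ θ.symm.toLinearMap ∘ₗ LinearMap.inl _ _ _
  let sP : S →ₗ[Sᵐᵒᵖ] P.carrier := LinearMap.fst _ _ _ ∘ₗ θ.toLinearMap ∘ₗ s
  let iQ : Q.carrier →ₗ[Sᵐᵒᵖ] S := i ∘ₗ θ.symm.toLinearMap ∘ₗ LinearMap.inr _ _ _
  let sQ : S →ₗ[Sᵐᵒᵖ] Q.carrier := LinearMap.snd _ _ _ ∘ₗ θ.toLinearMap ∘ₗ s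
  refine ⟨iP (sP 1), iQ (sQ 1), ?_, ?_, ?_, ⟨P, iP, sP, rfl, fun a => ?_, fun b => ?_⟩,
    ⟨Q, iQ, sQ, rfl, fun a => ?_, fun b => ?_⟩⟩
  · simp only [iP, iQ, sP, sQ, LinearMap.comp_apply, ← map_add]
    simp [h2]
  · rw [← LinearMap.comp_apply, ← apply_eq_mul]
    simp [iP, iQ, sP, sQ, h1, ← Prod.zero_eq_mk]
  · rw [← LinearMap.comp_apply, ← apply_eq_mul]
    simp [iP, iQ, sP, sQ, h1, ← Prod.zero_eq_mk]
  · simp [iP, sP, h1]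
  · rw [← LinearMap.comp_apply, ← LinearMap.comp_apply, ← apply_eq_mul]
  · simp [iQ, sQ, h1]
  · rw [← LinearMap.comp_apply, ← LinearMap.comp_apply, ← apply_eq_mul]

theorem exists_sum {ι : Type*} (A : Finset ι) {x : ι → VMonoid S}
    (h : IsClassOf p (∑ a ∈ A, x a)) :
    ∃ q : ι → S, ∑ a ∈ A, q a = p ∧ (∀ a ∈ A, IsClassOf (q a) (x a)) ∧
      ∀ a ∈ A, ∀ b ∈ A, a ≠ b → q a * q b = 0 := by
  classical
  induction A using Finset.induction_on generalizing p with
  | empty => exact ⟨0, by simp at h ⊢; exact h.eq_zero.symm, by simp, by simp⟩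
  | insert a A ha ih =>
    rw [Finset.sum_insert ha] at h
    obtain ⟨s, r, rfl, hsr, hrs, hs, hr⟩ := h.exists_add
    obtain ⟨q, hq, hc, ho⟩ := ih hr
    have hne : ∀ b ∈ A, b ≠ a := fun b hb hab => ha (hab ▸ hb)
    -- Since `r` is the orthogonal sum of the `q b`, it absorbs each of them, so orthogonality of
    -- `s` to `r` passes to every `q b`.
    have hrq : ∀ b ∈ A, r * q b = q b ∧ q b * r = q b := fun b hb => by
      rw [← hq, Finset.sum_mul, Finset.mul_sum]
      refine ⟨(Finset.sum_eq_single b (fun c hc hcb => ho c hc b hb hcb) (absurd hb)).trans ?_,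
        (Finset.sum_eq_single b (fun c hc hcb => ho b hb c hc hcb.symm) (absurd hb)).trans ?_⟩ <;>
      exact (hc b hb).isIdempotentElem
    refine ⟨fun b => if b = a then s else q b, ?_, ?_, ?_⟩
    · rw [Finset.sum_insert ha, if_pos rfl, ← hq]
      exact congrArg _ (Finset.sum_congr rfl fun b hb => if_neg (hne b hb))
    · intro b hb
      obtain rfl | hb := Finset.mem_insert.1 hb
      · simpa using hs
      · simpa [hne b hb] using hc b hb
    · intro b hb' c hc' hbc
      obtain rfl | hb := Finset.mem_insert.1 hb'
      · obtain rfl | hc := Finset.mem_insert.1 hc'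
        · exact absurd rfl hbc
        · simp only [if_pos, if_neg (hne c hc)]
          rw [← (hrq c hc).1, ← mul_assoc, hsr, zero_mul]
      · obtain rfl | hc := Finset.mem_insert.1 hc'
        · simp only [if_pos, if_neg (hne b hb)]
          rw [← (hrq b hb).2, mul_assoc, hrs, mul_zero]
        · simpa [hne b hb, hne c hc] using ho b hb c hc hbc

end IsClassOf

end VMonoid

/-! ### Invariance of `V` under isomorphism -/

namespace FGProjRight

variable {S T : Type v} [Semiring S] [Semiring T]

/-- Restriction of scalars along an isomorphism of semirings. -/
def restrict (e : T ≃+* S) (P : FGProjRight S) : FGProjRight T :=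
  letI := Module.compHom P.carrier (e : T →+* S).op
  letI := RingHomInvPair.of_ringEquiv (RingEquiv.op e.symm)
  letI := RingHomInvPair.symm (RingEquiv.op e.symm : Sᵐᵒᵖ →+* Tᵐᵒᵖ)
    ((RingEquiv.op e.symm).symm : Tᵐᵒᵖ →+* Sᵐᵒᵖ)
  -- The identity map is semilinear along the ring isomorphism, so finiteness and projectivity carry
  -- over.
  let θ : P.carrier ≃ₛₗ[(RingEquiv.op e.symm : Sᵐᵒᵖ →+* Tᵐᵒᵖ)] P.carrier :=
    { AddEquiv.refl P.carrier with
      map_smul' := fun r x =>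
        congrArg (· • x) (congrArg MulOpposite.op (e.apply_symm_apply r.unop)).symm }
  { carrier := P.carrier
    finite := Module.Finite.of_surjective θ.toLinearMap θ.surjective
    projective := Module.Projective.of_equiv θ }

end FGProjRight

namespace VMonoid

variable {S T : Type v} [Semiring S] [Semiring T]

/-- Restriction of scalars along an isomorphism of semirings, on isomorphism classes. -/
def restrict (e : T ≃+* S) : VMonoid S → VMonoid T :=
  Quotient.map (FGProjRight.restrict e) fun _ _ ⟨θ⟩ =>
    ⟨{ toFun := θ, invFun := θ.symm, left_inv := θ.left_inv, right_inv := θ.right_inv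
       map_add' := θ.map_add
       map_smul' := fun r x => θ.map_smul (MulOpposite.op (e r.unop)) x }⟩

theorem restrict_restrict (e : T ≃+* S) (x : VMonoid S) :
    restrict e.symm (restrict e x) = x := by
  obtain ⟨P, rfl⟩ := Quotient.exists_rep x
  exact Quotient.sound ⟨{ AddEquiv.refl P.carrier with
    map_smul' := fun r x => congrArg (fun s => MulOpposite.op s • (show P.carrier from x))
      (e.apply_symm_apply r.unop) }⟩

/-- Isomorphic semirings have isomorphic monoids `V`. -/
def congr (e : S ≃+* T) : VMonoid S ≃+ VMonoid T where
  toFun := restrict e.symm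
  invFun := restrict e
  left_inv := restrict_restrict e.symm
  right_inv := restrict_restrict e
  map_add' := by
    rintro ⟨P⟩ ⟨Q⟩
    exact Quotient.sound ⟨{ AddEquiv.refl (P.carrier × Q.carrier) with
      map_smul' := fun r x => rfl }⟩

theorem congr_regular (e : S ≃+* T) :
    congr e (mk (FGProjRight.regular S)) = mk (FGProjRight.regular T) :=
  Quotient.sound ⟨{ e.toAddEquiv with
    map_smul' := fun r (x : S) => by
      change e (x * e.symm r.unop) = e x * r.unop
      simp }⟩

end VMonoid

/-! ### Matrix units and homomorphisms from matricial algebras -/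

/-- The matricial algebra with blocks of sizes `m i + 1`. -/
abbrev MatAlg (F : Type u) [Semifield F] {r : ℕ} (m : Fin r → ℕ) : Type u :=
  (i : Fin r) → Matrix (Fin (m i + 1)) (Fin (m i + 1)) F

/-- A system of matrix units with blocks of sizes `m i + 1`. -/
structure IsMatrixUnits {B : Type*} [Semiring B] {r : ℕ} {m : Fin r → ℕ}
    (e : ∀ i, Fin (m i + 1) → Fin (m i + 1) → B) : Prop where
  mul_same : ∀ i k l t, e i k l * e i l t = e i k t
  mul_of_ne : ∀ i k l s t, l ≠ s → e i k l * e i s t = 0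
  mul_of_ne_block : ∀ i j, i ≠ j → ∀ k l s t, e i k l * e j s t = 0
  sum_one : ∑ i, ∑ k, e i k k = 1

namespace MatAlg

variable {F : Type u} [Semifield F] {r : ℕ} {m : Fin r → ℕ}
variable {B : Type*} [Semiring B] [Algebra F B]

/-- The standard matrix units. -/
def unit (F : Type u) [Semifield F] {r : ℕ} {m : Fin r → ℕ} (i : Fin r)
    (k l : Fin (m i + 1)) : MatAlg F m :=
  Pi.single i (Matrix.single k l 1)

theorem unit_self (i : Fin r) (k l : Fin (m i + 1)) :
    unit F i k l i = Matrix.single k l 1 := Pi.single_eq_same ..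

theorem unit_of_ne {i j : Fin r} (h : j ≠ i) (k l : Fin (m i + 1)) : unit F i k l j = 0 :=
  Pi.single_eq_of_ne h _

theorem eq_sum (x : MatAlg F m) : x = ∑ i, ∑ k, ∑ l, x i k l • unit F i k l := by
  ext j a b
  simp only [Finset.sum_apply, Matrix.sum_apply, Pi.smul_apply, Matrix.smul_apply, smul_eq_mul]
  rw [Finset.sum_eq_single j, Finset.sum_eq_single a, Finset.sum_eq_single b]
  · simp [unit_self]
  · intro l _ hl; simp [unit_self, hl]
  · simp
  · intro k _ hk; simp [unit_self, hk]
  · simp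
  · intro i _ hi; simp [unit_of_ne hi.symm]
  · simp

theorem isMatrixUnits_unit : IsMatrixUnits (unit F (m := m)) where
  mul_same i k l t := by simp [unit, ← Pi.single_mul]
  mul_of_ne i k l s t h := by
    simp [unit, ← Pi.single_mul, h]
  mul_of_ne_block i j h k l s t := by
    ext a : 1
    by_cases ha : a = i
    · subst ha; simp [unit, h]
    · simp [unit, ha]
  sum_one := by
    rw [eq_sum 1]
    refine Finset.sum_congr rfl fun i _ => Finset.sum_congr rfl fun k _ => ?_
    rw [Finset.sum_eq_single k]
    · simp
    · intro l _ hl; simp [hl.symm]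
    · simp

theorem algHom_ext {φ ψ : MatAlg F m →ₐ[F] B}
    (h : ∀ i k l, φ (unit F i k l) = ψ (unit F i k l)) : φ = ψ := by
  ext x
  rw [eq_sum x]
  simp only [map_sum, map_smul, h]

end MatAlg

namespace IsMatrixUnits

variable {F : Type u} [Semifield F] {r : ℕ} {m : Fin r → ℕ}
variable {B C : Type*} [Semiring B] [Semiring C]
variable {e : ∀ i, Fin (m i + 1) → Fin (m i + 1) → B}

theorem map (he : IsMatrixUnits e) (φ : B →+* C) :
    IsMatrixUnits fun i k l => φ (e i k l) where
  mul_same i k l t := by rw [← map_mul, he.mul_same]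
  mul_of_ne i k l s t h := by rw [← map_mul, he.mul_of_ne _ _ _ _ _ h, map_zero]
  mul_of_ne_block i j h k l s t := by rw [← map_mul, he.mul_of_ne_block _ _ h, map_zero]
  sum_one := by simp only [← map_sum, he.sum_one, map_one]

theorem isIdempotentElem (he : IsMatrixUnits e) (i k) : e i k k * e i k k = e i k k :=
  he.mul_same ..

theorem mul_self_of_ne (he : IsMatrixUnits e) (a b : (i : Fin r) × Fin (m i + 1)) (h : a ≠ b) :
    e a.1 a.2 a.2 * e b.1 b.2 b.2 = 0 := by
  obtain ⟨i, k⟩ := a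
  obtain ⟨j, l⟩ := b
  by_cases hij : i = j
  · subst hij
    exact he.mul_of_ne _ _ _ _ _ fun hkl => h (Sigma.ext rfl (heq_of_eq hkl))
  · exact he.mul_of_ne_block _ _ hij ..

theorem mvNEquiv (he : IsMatrixUnits e) (i k l) : MvNEquiv (e i k k) (e i l l) :=
  ⟨e i k l, e i l k, he.mul_same .., he.mul_same ..⟩

variable [Algebra F B]

/-- The algebra homomorphism from the matricial algebra given by a system of matrix units. -/
def lift (F : Type u) [Semifield F] [Algebra F B] (he : IsMatrixUnits e) : MatAlg F m →ₐ[F] B :=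
  AlgHom.ofLinearMap
    { toFun := fun x => ∑ i, ∑ k, ∑ l, x i k l • e i k l
      map_add' := fun x y => by
        simp only [Pi.add_apply, Matrix.add_apply, add_smul, Finset.sum_add_distrib]
      map_smul' := fun c x => by
        simp only [Pi.smul_apply, Matrix.smul_apply, smul_eq_mul, mul_smul, Finset.smul_sum,
          RingHom.id_apply] }
    (by
      rw [← he.sum_one]
      change ∑ i, ∑ k, ∑ l, (1 : MatAlg F m) i k l • e i k l = _
      refine Finset.sum_congr rfl fun i _ => Finset.sum_congr rfl fun k _ => ?_
      rw [Finset.sum_eq_single k] <;> simp +contextual [eq_comm])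
    (fun x y => by
      change ∑ i, ∑ k, ∑ l, (x * y) i k l • e i k l =
        (∑ i, ∑ k, ∑ l, x i k l • e i k l) * ∑ i, ∑ k, ∑ l, y i k l • e i k l
      rw [Finset.sum_mul]
      refine Finset.sum_congr rfl fun i _ => ?_
      rw [Finset.mul_sum, Finset.sum_eq_single i]
      · simp only [Finset.sum_mul]
        refine Finset.sum_congr rfl fun k _ => ?_
        have hrow (l : Fin (m i + 1)) : x i k l • e i k l * ∑ s, ∑ t, y i s t • e i s t =
            ∑ t, (x i k l * y i l t) • e i k t := by
          rw [Finset.mul_sum, Finset.sum_eq_single l]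
          · simp only [Finset.mul_sum, smul_mul_smul_comm, he.mul_same]
          · intro s _ hs
            simp only [Finset.mul_sum, smul_mul_smul_comm, he.mul_of_ne i k l s _ hs.symm,
              smul_zero, Finset.sum_const_zero]
          · simp
        simp only [hrow]
        rw [Finset.sum_comm]
        simp only [Pi.mul_apply, Matrix.mul_apply, Finset.sum_smul]
      · intro j _ hj
        simp only [Finset.mul_sum, Finset.sum_mul, smul_mul_smul_comm,
          he.mul_of_ne_block i j hj.symm, smul_zero, Finset.sum_const_zero]
      · simp)

theorem lift_unit (he : IsMatrixUnits e) (i k l) :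
    he.lift F (MatAlg.unit F i k l) = e i k l := by
  change ∑ i', ∑ k', ∑ l', MatAlg.unit F i k l i' k' l' • e i' k' l' = _
  rw [Finset.sum_eq_single i, Finset.sum_eq_single k, Finset.sum_eq_single l]
  all_goals simp +contextual [MatAlg.unit, Matrix.single_apply, eq_comm]

end IsMatrixUnits

namespace MatAlg

variable {F : Type u} [Semifield F] {r : ℕ} {m : Fin r → ℕ}
variable {B : Type*} [Semiring B] [Algebra F B]

theorem isMatrixUnits (φ : MatAlg F m →ₐ[F] B) : IsMatrixUnits fun i k l => φ (unit F i k l) :=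
  isMatrixUnits_unit.map φ.toRingHom

/-- Conjugation of an algebra homomorphism by a unit. -/
def conj {A : Type*} [Semiring A] [Algebra F A] (φ : A →ₐ[F] B) (u : Bˣ) : A →ₐ[F] B :=
  AlgHom.ofLinearMap
    (LinearMap.mulLeft F (u : B) ∘ₗ LinearMap.mulRight F (↑u⁻¹ : B) ∘ₗ φ.toLinearMap)
    (by simp) (fun x y => by simp [mul_assoc])

theorem conj_apply {A : Type*} [Semiring A] [Algebra F A] (φ : A →ₐ[F] B) (u : Bˣ) (x : A) :
    conj φ u x = u * (φ x * ↑u⁻¹) := rfl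

/-- Two homomorphisms from a matricial algebra which agree on minimal idempotents up to
equivalence are conjugate. -/
theorem exists_conj (φ ψ : MatAlg F m →ₐ[F] B)
    (h : ∀ i, MvNEquiv (φ (unit F i 0 0)) (ψ (unit F i 0 0))) :
    ∃ u : Bˣ, ∀ x, (u : B) * (φ x * ↑u⁻¹) = ψ x := by
  choose y x hyx hxy using h
  have hφ := isMatrixUnits φ
  have hψ := isMatrixUnits ψ
  -- The conjugating element moves index `k` of `φ` to the corner `0`, crosses to `ψ` by `x i`, and
  -- moves back to `k`. The homomorphisms are generalized so that exchanging them yields the other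
  -- inverse identity.
  have key {φ ψ : MatAlg F m →ₐ[F] B} (hφ : IsMatrixUnits fun i k l => φ (unit F i k l))
      (hψ : IsMatrixUnits fun i k l => ψ (unit F i k l)) {x y : Fin r → B}
      (hyx : ∀ i, y i * x i = φ (unit F i 0 0)) (hxy : ∀ i, x i * y i = ψ (unit F i 0 0)) :
      (∑ i, ∑ k, ψ (unit F i k 0) * x i * φ (unit F i 0 k)) *
        (∑ i, ∑ k, φ (unit F i k 0) * y i * ψ (unit F i 0 k)) = 1 := by
    rw [← hψ.sum_one, Finset.sum_mul]
    refine Finset.sum_congr rfl fun i _ => ?_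
    rw [Finset.sum_mul]
    refine Finset.sum_congr rfl fun k _ => ?_
    rw [Finset.mul_sum, Finset.sum_eq_single i, Finset.mul_sum, Finset.sum_eq_single k]
    · calc _ = ψ (unit F i k 0) * x i * (φ (unit F i 0 k) * φ (unit F i k 0)) * y i *
            ψ (unit F i 0 k) := by simp only [mul_assoc]
        _ = ψ (unit F i k 0) * (x i * y i) * (x i * y i) * ψ (unit F i 0 k) := by
          rw [hφ.mul_same, ← hyx]; simp only [mul_assoc]
        _ = _ := by rw [hxy, hψ.mul_same, hψ.mul_same, hψ.mul_same]
    · intro l _ hl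
      calc _ = ψ (unit F i k 0) * x i * (φ (unit F i 0 k) * φ (unit F i l 0)) * y i *
            ψ (unit F i 0 l) := by simp only [mul_assoc]
        _ = 0 := by rw [hφ.mul_of_ne _ _ _ _ _ hl.symm]; simp
    · simp
    · intro j _ hj
      rw [Finset.mul_sum]
      refine Finset.sum_eq_zero fun l _ => ?_
      calc _ = ψ (unit F i k 0) * x i * (φ (unit F i 0 k) * φ (unit F j l 0)) * y j *
            ψ (unit F j 0 l) := by simp only [mul_assoc]
        _ = 0 := by rw [hφ.mul_of_ne_block _ _ hj.symm]; simp
    · simp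
  let u : Bˣ := ⟨_, _, key hφ hψ hyx hxy, key hψ hφ hxy hyx⟩
  have hu : (u : B) = ∑ i, ∑ k, ψ (unit F i k 0) * x i * φ (unit F i 0 k) := rfl
  -- Orthogonality leaves one term of each sum, and the two surviving terms agree.
  have hunit (i s t) : (u : B) * φ (unit F i s t) = ψ (unit F i s t) * u := by
    trans ψ (unit F i s 0) * x i * φ (unit F i 0 t)
    · rw [hu, Finset.sum_mul, Finset.sum_eq_single i, Finset.sum_mul, Finset.sum_eq_single s]
      · rw [mul_assoc, hφ.mul_same]
      · intro k _ hk
        rw [mul_assoc, hφ.mul_of_ne _ _ _ _ _ hk, mul_zero]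
      · simp
      · intro j _ hj
        rw [Finset.sum_mul]
        exact Finset.sum_eq_zero fun k _ => by
          rw [mul_assoc, hφ.mul_of_ne_block _ _ hj, mul_zero]
      · simp
    · rw [hu, Finset.mul_sum, Finset.sum_eq_single i, Finset.mul_sum, Finset.sum_eq_single t]
      · rw [← mul_assoc, ← mul_assoc, hψ.mul_same]
      · intro k _ hk
        rw [← mul_assoc, ← mul_assoc, hψ.mul_of_ne _ _ _ _ _ hk.symm, zero_mul, zero_mul]
      · simp
      · intro j _ hj
        rw [Finset.mul_sum]
        exact Finset.sum_eq_zero fun k _ => by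
          rw [← mul_assoc, ← mul_assoc, hψ.mul_of_ne_block _ _ hj.symm, zero_mul, zero_mul]
      · simp
  have : conj φ u = ψ := algHom_ext fun i k l => by
    rw [conj_apply, ← mul_assoc, hunit, mul_assoc, Units.mul_inv, mul_one]
  exact ⟨u, fun x => congrArg (· x) this⟩

end MatAlg

open VMonoid in
/-- A decomposition of the class of the regular semimodule yields a homomorphism from a matricial
algebra. -/
theorem VMonoid.exists_algHom {F : Type u} [Semifield F] {r : ℕ} {m : Fin r → ℕ}
    {B : Type v} [Semiring B] [Algebra F B] (x : Fin r → VMonoid B)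
    (hx : ∑ a : (i : Fin r) × Fin (m i + 1), x a.1 = mk (FGProjRight.regular B)) :
    ∃ φ : MatAlg F m →ₐ[F] B, ∀ i k, IsClassOf (φ (MatAlg.unit F i k k)) (x i) := by
  obtain ⟨p, h1, hp, ho⟩ := IsClassOf.exists_sum Finset.univ (hx ▸ IsClassOf.one)
  replace hp := fun a => hp a (Finset.mem_univ a)
  have hpi (a) := (hp a).isIdempotentElem
  have huv (i) (k : Fin (m i + 1)) : ∃ u v : B, u * v = p ⟨i, k⟩ ∧ v * u = p ⟨i, 0⟩ ∧
      p ⟨i, k⟩ * u = u ∧ u * p ⟨i, 0⟩ = u ∧ v * p ⟨i, k⟩ = v := by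
    obtain ⟨u, v, huv, hvu⟩ := (hp ⟨i, k⟩).mvNEquiv (hp ⟨i, 0⟩)
    have h3 : p ⟨i, k⟩ * u = u * p ⟨i, 0⟩ := by rw [← huv, ← hvu, mul_assoc]
    have h4 : p ⟨i, 0⟩ * v = v * p ⟨i, k⟩ := by rw [← huv, ← hvu, mul_assoc]
    -- Cutting `u` and `v` down by the idempotents makes them partial isometries between `p ⟨i, 0⟩`
    -- and `p ⟨i, k⟩`, so that the products `u i k * v i l` are matrix units.
    refine ⟨p ⟨i, k⟩ * u, v * p ⟨i, k⟩, ?_, ?_, ?_, ?_, ?_⟩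
    · rw [mul_assoc, ← mul_assoc u, huv, hpi, hpi]
    · rw [mul_assoc, ← mul_assoc _ _ u, hpi, h3, ← mul_assoc, hvu, hpi]
    · rw [← mul_assoc, hpi]
    · rw [h3, mul_assoc, hpi]
    · rw [mul_assoc, hpi]
  choose u v huv hvu hpu hup hvp using huv
  have he : IsMatrixUnits fun i k l => u i k * v i l := by
    refine ⟨fun i k l t => ?_, fun i k l s t h => ?_, fun i j h k l s t => ?_, ?_⟩
    · rw [mul_assoc, ← mul_assoc (v i l), hvu, ← mul_assoc, hup]
    · rw [← hvp i l, ← hpu i s, mul_assoc, ← mul_assoc (v i l * _), mul_assoc (v i l),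
        ← mul_assoc (p _) (p _), ho _ (Finset.mem_univ _) _ (Finset.mem_univ _)]
      · simp
      · simpa using h
    · rw [← hvp i l, ← hpu j s, mul_assoc, ← mul_assoc (v i l * _), mul_assoc (v i l),
        ← mul_assoc (p _) (p _), ho _ (Finset.mem_univ _) _ (Finset.mem_univ _)]
      · simp
      · simp [h]
    · simp only [huv]
      rw [← h1, ← Finset.univ_sigma_univ, Finset.sum_sigma]
  exact ⟨he.lift F, fun i k => by rw [he.lift_unit, huv]; exact hp ⟨i, k⟩⟩

/-! ### Direct limits of matricial algebras -/

open Filter in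
/-- Matrix units lift along a directed union of algebras. -/
theorem IsMatrixUnits.exists_lift {A : ℕ → Type*} [∀ i, Semiring (A i)]
    {S : Type*} [Semiring S] {f : ∀ i j : ℕ, i ≤ j → A i →+* A j} {ι : ∀ i, A i →+* S}
    (hι : ∀ i j h x, ι j (f i j h x) = ι i x) (hsurj : ∀ s, ∃ i x, ι i x = s)
    (hinj : ∀ i x y, ι i x = ι i y → ∀ᶠ j in atTop, ∀ h, f i j h x = f i j h y)
    {r : ℕ} {m : Fin r → ℕ} {e : ∀ i, Fin (m i + 1) → Fin (m i + 1) → S}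
    (he : IsMatrixUnits e) (n : ℕ) :
    ∃ j, n ≤ j ∧ ∃ e' : ∀ i, Fin (m i + 1) → Fin (m i + 1) → A j,
      IsMatrixUnits e' ∧ ∀ i k l, ι j (e' i k l) = e i k l := by
  choose c x hx using fun q : (i : Fin r) × Fin (m i + 1) × Fin (m i + 1) =>
    hsurj (e q.1 q.2.1 q.2.2)
  obtain ⟨N, hN⟩ := Finite.exists_le c
  let s := max n N
  have hs (q) : c q ≤ s := (hN q).trans (le_max_right _ _)
  let y (i k l) : A s := f _ s (hs ⟨i, k, l⟩) (x ⟨i, k, l⟩)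
  have hy (i k l) : ι s (y i k l) = e i k l := by rw [hι, hx]
  -- The defining relations are finite in number and hold in `S`, so all of them hold at every late
  -- enough stage.
  have h1 : ∀ᶠ j in atTop, ∀ i k l t, ∀ h,
      f s j h (y i k l * y i l t) = f s j h (y i k t) := by
    simp only [eventually_all]
    refine fun i k l t => ?_
    simpa only [eventually_all] using hinj _ _ _ (by rw [map_mul, hy, hy, hy, he.mul_same])
  have h2 : ∀ᶠ j in atTop, ∀ i k l s' t, l ≠ s' → ∀ h,
      f s j h (y i k l * y i s' t) = f s j h 0 := by
    simp only [eventually_all]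
    refine fun i k l s' t hl => ?_
    exact hinj _ _ _ (by rw [map_mul, hy, hy, he.mul_of_ne _ _ _ _ _ hl, map_zero])
  have h3 : ∀ᶠ j in atTop, ∀ i i', i ≠ i' → ∀ k l s' t, ∀ h,
      f s j h (y i k l * y i' s' t) = f s j h 0 := by
    simp only [eventually_all]
    refine fun i i' hi k l s' t => ?_
    exact hinj _ _ _ (by rw [map_mul, hy, hy, he.mul_of_ne_block _ _ hi, map_zero])
  have h4 : ∀ᶠ j in atTop, ∀ h, f s j h (∑ i, ∑ k, y i k k) = f s j h 1 :=
    hinj _ _ _ (by simp only [map_sum, hy, he.sum_one, map_one])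
  obtain ⟨j, hj1, hj2, hj3, hj4, hsj⟩ :=
    (h1.and (h2.and (h3.and (h4.and (eventually_ge_atTop s))))).exists
  refine ⟨j, (le_max_left _ _).trans hsj, fun i k l => f s j hsj (y i k l), ⟨?_, ?_, ?_, ?_⟩, ?_⟩
  · intro i k l t
    rw [← map_mul, hj1]
  · intro i k l s' t h
    rw [← map_mul, hj2 _ _ _ _ _ h, map_zero]
  · intro i i' h k l s' t
    rw [← map_mul, hj3 _ _ h, map_zero]
  · simp only [← map_sum]
    rw [hj4, map_one]
  · intro i k l
    rw [hι, hy]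

namespace IsMatricial

variable {F : Type u} [Semifield F] {A : Type v} [Semiring A] [Algebra F A]

/-- Writing sizes as `m i + 1` gives every block an index `0`, whose diagonal unit serves as the
chosen minimal idempotent. -/
theorem exists_equiv (h : IsMatricial F A) :
    ∃ (r : ℕ) (m : Fin r → ℕ), Nonempty (A ≃ₐ[F] MatAlg F m) := by
  obtain ⟨r, n, hn, h⟩ := h
  obtain ⟨m, rfl⟩ : ∃ m : Fin r → ℕ, n = fun i => m i + 1 :=
    ⟨fun i => n i - 1, funext fun i => (Nat.sub_add_cancel (hn i)).symm⟩
  exact ⟨r, m, h⟩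

/-- A nonzero element has a nonzero entry, which cancels in `F`. This cancellation later replaces
arguments with kernels. -/
theorem eq_of_smul_eq (h : IsMatricial F A) {a b : F} {p : A} (hab : a • p = b • p)
    (hp : p ≠ 0) : a = b := by
  obtain ⟨r, m, ⟨e⟩⟩ := h.exists_equiv
  by_contra hne
  refine hp (e.injective ?_)
  rw [map_zero]
  ext i k l
  by_contra h0
  refine hne (mul_right_cancel₀ (b := e p i k l) h0 ?_)
  have := congrArg (fun x => e x i k l) hab
  simpa using this

end IsMatricial

namespace IsUltramatricial

variable {F : Type u} [Semifield F] {S : Type v} [Semiring S] [Algebra F S]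

/-- An ultramatricial algebra is a directed union of images of matricial algebras. -/
theorem exists_stages (h : IsUltramatricial F S) :
    ∃ (A : ℕ → Type u) (_ : ∀ i, Semiring (A i)) (_ : ∀ i, Algebra F (A i))
      (f : ∀ i j : ℕ, i ≤ j → A i →ₐ[F] A j) (ι : ∀ i, A i →ₐ[F] S),
      (∀ i, IsMatricial F (A i)) ∧ (∀ i j h x, ι j (f i j h x) = ι i x) ∧
      (∀ s, ∃ i x, ι i x = s) ∧
      ∀ i x y, ι i x = ι i y → ∀ᶠ j in Filter.atTop, ∀ h, f i j h x = f i j h y := by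
  obtain ⟨A, _, _, f, hf, hA, ⟨e⟩⟩ := h
  let ι (i) : A i →ₐ[F] DirectLimit A f :=
    { toFun := fun x => ⟦⟨i, x⟩⟧
      map_one' := (DirectLimit.one_def i).symm
      map_mul' := fun _ _ => (DirectLimit.mul_def ..).symm
      map_zero' := (DirectLimit.zero_def i).symm
      map_add' := fun _ _ => (DirectLimit.add_def ..).symm
      commutes' := fun c => (DirectLimit.algebraMap_def i c).symm }
  refine ⟨A, _, _, f, fun i => e.symm.toAlgHom.comp (ι i), hA, fun i j h x => ?_, fun s => ?_,
    fun i x y hxy => ?_⟩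
  · exact congrArg e.symm (DirectLimit.mk_apply i j x h)
  · obtain ⟨i, x, hx⟩ := DirectLimit.exists_eq_mk _ (e s)
    exact ⟨i, x, (congrArg e.symm hx.symm).trans (e.symm_apply_apply s)⟩
  · obtain ⟨j, h, _, hj⟩ := Quotient.exact (e.symm.injective hxy)
    filter_upwards [Filter.eventually_ge_atTop j] with k hk hik
    have := congrArg (f j k hk) hj
    rwa [DirectedSystem.map_map' (f := (f · · ·)), DirectedSystem.map_map' (f := (f · · ·))] at this

theorem eq_of_smul_eq (h : IsUltramatricial F S) {a b : F} {p : S} (hab : a • p = b • p)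
    (hp : p ≠ 0) : a = b := by
  obtain ⟨A, _, _, f, ι, hA, hι, hsurj, hinj⟩ := h.exists_stages
  obtain ⟨i, x, rfl⟩ := hsurj p
  obtain ⟨j, hj, hij⟩ :=
    ((hinj i (a • x) (b • x) (by simpa using hab)).and (Filter.eventually_ge_atTop i)).exists
  refine (hA j).eq_of_smul_eq (p := f i j hij x) (by simpa using hj hij) fun h0 => hp ?_
  rw [← hι i j hij, h0, map_zero]

/-- Homomorphisms from matricial algebras to an ultramatricial algebra factor through arbitrarily
large matricial stages. -/
theorem exists_factor (h : IsUltramatricial F S) :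
    ∃ C : ℕ → Set S, (∀ s, ∃ k, s ∈ C k) ∧
      ∀ {r : ℕ} {n : Fin r → ℕ} (φ : MatAlg F n →ₐ[F] S) (k : ℕ),
        ∃ (r' : ℕ) (m : Fin r' → ℕ) (ι : MatAlg F m →ₐ[F] S) (φ' : MatAlg F n →ₐ[F] MatAlg F m),
          (∀ x, ι (φ' x) = φ x) ∧ ∀ s ∈ C k, ∃ x, ι x = s := by
  obtain ⟨A, _, _, f, ι, hA, hι, hsurj, hinj⟩ := h.exists_stages
  -- `C k` is the image of stage `k`. A lift of the matrix units of `φ` to a stage `j ≥ k` also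
  -- covers `C k`.
  refine ⟨fun k => Set.range (ι k), hsurj, fun {r n} φ k => ?_⟩
  obtain ⟨j, hkj, e', he', hιe⟩ := IsMatrixUnits.exists_lift
    (f := fun i j h => (f i j h).toRingHom) (ι := fun i => (ι i).toRingHom)
    hι hsurj hinj (MatAlg.isMatrixUnits φ) k
  obtain ⟨r', m, ⟨ε⟩⟩ := (hA j).exists_equiv
  refine ⟨r', m, (ι j).comp ε.symm.toAlgHom, ε.toAlgHom.comp (he'.lift F), fun x => ?_, ?_⟩
  · have : (ι j).comp (he'.lift F) = φ := MatAlg.algHom_ext fun i k l => by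
      simpa [he'.lift_unit] using hιe i k l
    simpa using congrArg (· x) this
  · rintro _ ⟨x, rfl⟩
    exact ⟨ε (f k j hkj x), by simpa using hι k j hkj x⟩

end IsUltramatricial

/-! ### Complemented idempotents over a semifield -/

namespace Matrix

/-- An idempotent matrix over a field is equivalent to a diagonal idempotent. -/
theorem exists_mvNEquiv_of_field {F : Type*} [Field F] {n : ℕ} {P : Matrix (Fin n) (Fin n) F}
    (hP : P * P = P) :
    ∃ d : Finset (Fin n), MvNEquiv P (∑ k ∈ d, Matrix.single k k 1) := by
  let W := LinearMap.range (toLin' P)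
  let b := Module.finBasis F W
  have hk : Module.finrank F W ≤ n := by simpa using Submodule.finrank_le W
  let g : Fin (Module.finrank F W) → Fin n := Fin.castLE hk
  have hg : Function.Injective g := Fin.castLE_injective hk
  let E : (Fin (Module.finrank F W) → F) →ₗ[F] (Fin n → F) := Function.ExtendByZero.linearMap F g
  let R : (Fin n → F) →ₗ[F] (Fin (Module.finrank F W) → F) := LinearMap.funLeft F F g
  have hRE (x) : R (E x) = x := by
    ext i
    simp [R, E, Function.ExtendByZero.linearMap_apply, LinearMap.funLeft_apply, hg.extend_apply]
  -- `x` and `y` identify the range of `P` with the span of the first `finrank F W` coordinates: `x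
  -- ∘ y` is `P`, and `y ∘ x` is the coordinate projection `E ∘ R`.
  let x := W.subtype ∘ₗ b.equivFun.symm.toLinearMap ∘ₗ R
  let y := E ∘ₗ b.equivFun.toLinearMap ∘ₗ (toLin' P).rangeRestrict
  have hW (w : W) : (toLin' P).rangeRestrict w = w := by
    obtain ⟨_, z, rfl⟩ := w
    exact Subtype.ext (by simp [hP])
  refine ⟨Finset.univ.image g, LinearMap.toMatrix' x, LinearMap.toMatrix' y, ?_, ?_⟩
  · rw [← LinearMap.toMatrix'_comp]
    conv_rhs => rw [← LinearMap.toMatrix'_toLin' P]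
    congr 1
    ext1 i
    ext1
    simp [x, y, hRE]
  · rw [← LinearMap.toMatrix'_comp]
    have : y ∘ₗ x = E ∘ₗ R := by
      refine LinearMap.ext fun z => ?_
      simp only [x, y, LinearMap.comp_apply]
      rw [Submodule.subtype_apply, hW, LinearEquiv.coe_coe, LinearEquiv.coe_coe,
        LinearEquiv.apply_symm_apply]
    rw [this]
    ext s t
    rw [LinearMap.toMatrix'_apply, Matrix.sum_apply]
    simp only [LinearMap.comp_apply, E, R, Function.ExtendByZero.linearMap_apply]
    by_cases hs : ∃ i, g i = s
    · obtain ⟨i, rfl⟩ := hs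
      rw [hg.extend_apply, LinearMap.funLeft_apply, Finset.sum_eq_single (g i)]
      · simp [Matrix.single_apply, Pi.single_apply]
      · intro k _ hk
        simp [hk]
      · simp
    · rw [Function.extend_apply' _ _ _ hs, Finset.sum_eq_zero]
      · rfl
      · intro k hk
        obtain ⟨i, -, rfl⟩ := Finset.mem_image.1 hk
        have : g i ≠ s := fun h => hs ⟨i, h⟩
        simp [this]

/-- A complemented idempotent matrix over a zerosumfree semifield is diagonal with entries in
`{0, 1}`. -/
theorem exists_eq_of_zerosumfree {F : Type*} [Semifield F]
    (hF : ∀ a b : F, a + b = 0 → a = 0) {n : ℕ} {P Q : Matrix (Fin n) (Fin n) F}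
    (h1 : P + Q = 1) (h0 : P * Q = 0) :
    ∃ d : Finset (Fin n), P = ∑ k ∈ d, Matrix.single k k 1 := by
  classical
  -- Off the diagonal the entries of `P` and `Q` sum to zero, hence vanish; on it they sum to one
  -- and multiply to zero.
  have hoff (i j) (hij : i ≠ j) : P i j = 0 := hF _ (Q i j) <| by
    rw [← Matrix.add_apply, h1, Matrix.one_apply_ne hij]
  have hdiag (i) : P i i = 0 ∨ P i i = 1 := by
    have h : P i i * Q i i = 0 := by
      have := congrFun (congrFun h0 i) i
      rwa [Matrix.mul_apply, Finset.sum_eq_single i (fun j _ hj => by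
        rw [hoff i j hj.symm, zero_mul]) (by simp)] at this
    refine (mul_eq_zero.1 h).imp_right fun h => ?_
    have := congrFun (congrFun h1 i) i
    rwa [Matrix.add_apply, h, add_zero, Matrix.one_apply_eq] at this
  refine ⟨Finset.univ.filter fun i => P i i = 1, ?_⟩
  ext i j
  rw [Matrix.sum_apply]
  by_cases hij : i = j
  · subst hij
    obtain h | h := hdiag i
    · rw [h, Finset.sum_eq_zero]
      intro k hk
      rw [Matrix.single_apply, if_neg]
      rintro ⟨rfl, -⟩
      simp [h] at hk
    · rw [h, Finset.sum_eq_single i]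
      · simp
      · intro k _ hk
        simp [hk]
      · simp [h]
  · rw [hoff i j hij, Finset.sum_eq_zero]
    intro k _
    rw [Matrix.single_apply, if_neg]
    rintro ⟨rfl, rfl⟩
    exact hij rfl

/-- A complemented idempotent matrix over a semifield is equivalent to a diagonal idempotent. -/
theorem exists_mvNEquiv_of_semifield {F : Type*} [Semifield F] {n : ℕ}
    {P Q : Matrix (Fin n) (Fin n) F} (h1 : P + Q = 1) (h0 : P * Q = 0) :
    ∃ d : Finset (Fin n), MvNEquiv P (∑ k ∈ d, Matrix.single k k 1) := by
  have hP : P * P = P := by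
    conv_rhs => rw [← mul_one P, ← h1, mul_add, h0, add_zero]
  -- An additive inverse of `1` makes `F` a field. Otherwise `F` is zerosumfree, because `a + b = 0`
  -- with `a ≠ 0` would make `a⁻¹ * b` such an inverse.
  by_cases hF : ∃ c : F, c + 1 = 0
  · obtain ⟨c, hc⟩ := hF
    let _ : Neg F := ⟨fun a => c * a⟩
    let _ : Field F :=
      { ‹Semifield F› with
        zsmul := zsmulRec
        neg_add_cancel := fun a => by
          change c * a + a = 0
          rw [← add_one_mul, hc, zero_mul]
        qsmul := _
        nnqsmul := _ }
    exact exists_mvNEquiv_of_field hP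
  · obtain ⟨d, hd⟩ := exists_eq_of_zerosumfree (fun a b hab => by
      by_contra ha
      refine hF ⟨a⁻¹ * b, ?_⟩
      rw [← inv_mul_cancel₀ ha, ← mul_add, add_comm, hab, mul_zero]) h1 h0
    exact ⟨d, P, P, hP, hP.trans hd⟩

end Matrix

/-- A complemented idempotent in a matricial algebra is equivalent to a sum of diagonal matrix
units. -/
theorem MatAlg.exists_mvNEquiv {F : Type u} [Semifield F] {r : ℕ} {m : Fin r → ℕ}
    {p q : MatAlg F m} (h1 : p + q = 1) (h0 : p * q = 0) :
    ∃ D : Finset ((i : Fin r) × Fin (m i + 1)),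
      MvNEquiv p (∑ a ∈ D, MatAlg.unit F a.1 a.2 a.2) := by
  choose d x y hxy hyx using fun i =>
    Matrix.exists_mvNEquiv_of_semifield (congrFun h1 i) (congrFun h0 i)
  refine ⟨Finset.univ.sigma d, x, y, funext hxy, funext fun i => ?_⟩
  rw [Pi.mul_apply, hyx, Finset.sum_sigma, Finset.sum_apply, Finset.sum_eq_single i]
  · simp [MatAlg.unit_self]
  · intro j _ hj
    simp [MatAlg.unit_of_ne hj.symm]
  · simp

/-! ### Transporting homomorphisms along `f` -/

namespace MatAlg

variable {F : Type u} [Semifield F] {S T : Type v} [Semiring S] [Algebra F S] [Semiring T]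
  [Algebra F T] {r : ℕ} {n : Fin r → ℕ}

theorem unit_mul_mul_unit (x : MatAlg F n) (i : Fin r) (k l : Fin (n i + 1)) :
    unit F i 0 k * x * unit F i l 0 = x i k l • (unit F i 0 0 : MatAlg F n) := by
  funext j
  by_cases hj : j = i
  · subst hj
    simp [unit_self, Matrix.single_mul_mul_single]
  · simp [unit_of_ne hj]

/-- Homomorphisms `φ` and `ψ` correspond under `f` on the classes of minimal idempotents. -/
def Linked (f : VMonoid S ≃+ VMonoid T) (φ : MatAlg F n →ₐ[F] S) (ψ : MatAlg F n →ₐ[F] T) : Prop :=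
  ∀ i, ∃ x, VMonoid.IsClassOf (φ (unit F i 0 0)) x ∧ VMonoid.IsClassOf (ψ (unit F i 0 0)) (f x)

namespace Linked

variable {f : VMonoid S ≃+ VMonoid T} {φ : MatAlg F n →ₐ[F] S} {ψ : MatAlg F n →ₐ[F] T}

theorem symm (h : Linked f φ ψ) : Linked f.symm ψ φ := fun i => by
  obtain ⟨x, h1, h2⟩ := h i
  exact ⟨f x, h2, by rwa [f.symm_apply_apply]⟩

/-- Compressing to the corner of block `i` compares `x` and `y` entry by entry. If `φ` does not kill
the block, the entries agree; if it does, the class is zero, `f` preserves zero, and `ψ` kills the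
block too. -/
theorem apply_eq_of_apply_eq (h : Linked f φ ψ)
    (hS : ∀ (a b : F) (p : S), a • p = b • p → p ≠ 0 → a = b) {x y : MatAlg F n}
    (hxy : φ x = φ y) : ψ x = ψ y := by
  rw [eq_sum x, eq_sum y]
  simp only [map_sum, map_smul]
  refine Finset.sum_congr rfl fun i _ => Finset.sum_congr rfl fun k _ =>
    Finset.sum_congr rfl fun l _ => ?_
  have hkl : x i k l • φ (unit F i 0 0) = y i k l • φ (unit F i 0 0) := by
    rw [← map_smul, ← map_smul, ← unit_mul_mul_unit, ← unit_mul_mul_unit]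
    simp only [map_mul, hxy]
  by_cases h0 : φ (unit F i 0 0) = 0
  · obtain ⟨c, h1, h2⟩ := h i
    rw [h0] at h1
    rw [h1.eq_of_eq VMonoid.IsClassOf.zero, map_zero] at h2
    have hψ := isMatrixUnits ψ
    rw [← hψ.mul_same i k 0 l, ← hψ.mul_same i k 0 0, h2.eq_zero]
    simp
  · rw [hS _ _ _ hkl h0]

/-- The extension step of the back-and-forth construction. -/
theorem exists_extension (h : Linked f φ ψ)
    (hf : f (VMonoid.mk (FGProjRight.regular S)) = VMonoid.mk (FGProjRight.regular T))
    {r' : ℕ} {m : Fin r' → ℕ} {φ' : MatAlg F m →ₐ[F] S} {θ : MatAlg F n →ₐ[F] MatAlg F m}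
    (hθ : ∀ x, φ' (θ x) = φ x) :
    ∃ ψ' : MatAlg F m →ₐ[F] T, (∀ x, ψ' (θ x) = ψ x) ∧ Linked f φ' ψ' := by
  have hφ' := isMatrixUnits φ'
  choose c hc using fun i =>
    VMonoid.IsClassOf.exists_of_isIdempotentElem (hφ'.isIdempotentElem i 0)
  have hc' (i k) : VMonoid.IsClassOf (φ' (unit F i k k)) (c i) :=
    (hc i).of_mvNEquiv (hφ'.isIdempotentElem i k) (hφ'.mvNEquiv i 0 k)
  -- The diagonal units of `φ'` decompose the class of `S`; applying `f` decomposes the class of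
  -- `T`.
  have hsum : ∑ a : (i : Fin r') × Fin (m i + 1), f (c a.1) =
      VMonoid.mk (FGProjRight.regular T) := by
    rw [← map_sum, ← hf]
    congr 1
    refine (VMonoid.IsClassOf.sum Finset.univ (fun a _ => hc' a.1 a.2)
      fun a _ b _ hab => hφ'.mul_self_of_ne a b hab).eq_of_eq ?_
    rw [← Finset.univ_sigma_univ, Finset.sum_sigma, hφ'.sum_one]
    exact VMonoid.IsClassOf.one
  obtain ⟨ψ₀, hψ₀⟩ := VMonoid.exists_algHom (F := F) (m := m) (fun i => f (c i)) hsum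
  have hu : ∀ i, MvNEquiv ((ψ₀.comp θ) (unit F i 0 0)) (ψ (unit F i 0 0)) := by
    intro i
    have hn := isMatrixUnits_unit (F := F) (m := n)
    set p : MatAlg F n := unit F i 0 0 with hp
    -- The complement `q` is the sum of the other diagonal units. It makes `θ p` complemented, so a
    -- single `D` computes the class of `θ p` under both `φ'` and `ψ₀`.
    obtain ⟨q, h1, h0⟩ : ∃ q, p + q = 1 ∧ p * q = 0 := by
      refine ⟨∑ a ∈ (Finset.univ : Finset ((j : Fin r) × Fin (n j + 1))).erase ⟨i, 0⟩,
        unit F a.1 a.2 a.2, ?_, ?_⟩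
      · rw [hp, Finset.add_sum_erase _ (fun a : (j : Fin r) × Fin (n j + 1) =>
          unit F a.1 a.2 a.2) (Finset.mem_univ (⟨i, 0⟩ : (j : Fin r) × Fin (n j + 1))),
          ← hn.sum_one, ← Finset.univ_sigma_univ, Finset.sum_sigma]
      · rw [Finset.mul_sum]
        exact Finset.sum_eq_zero fun a ha =>
          hn.mul_self_of_ne ⟨i, 0⟩ a (Finset.ne_of_mem_erase ha).symm
    obtain ⟨D, hD⟩ := exists_mvNEquiv (p := θ p) (q := θ q)
      (by rw [← map_add, h1, map_one]) (by rw [← map_mul, h0, map_zero])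
    have hpp : p * p = p := hn.isIdempotentElem i 0
    have hS : VMonoid.IsClassOf (φ' (θ p)) (∑ a ∈ D, c a.1) := by
      refine VMonoid.IsClassOf.of_mvNEquiv ?_ (by rw [← map_mul, ← map_mul, hpp])
        (hD.map φ').symm
      rw [map_sum]
      exact VMonoid.IsClassOf.sum D (fun a _ => hc' a.1 a.2)
        fun a _ b _ hab => hφ'.mul_self_of_ne a b hab
    have hT : VMonoid.IsClassOf (ψ₀ (θ p)) (∑ a ∈ D, f (c a.1)) := by
      refine VMonoid.IsClassOf.of_mvNEquiv ?_ (by rw [← map_mul, ← map_mul, hpp])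
        (hD.map ψ₀).symm
      rw [map_sum]
      exact VMonoid.IsClassOf.sum D (fun a _ => hψ₀ a.1 a.2)
        fun a _ b _ hab => (isMatrixUnits ψ₀).mul_self_of_ne a b hab
    obtain ⟨x, hx, hx'⟩ := h i
    rw [← hθ] at hx
    rw [hx.eq_of_eq hS, map_sum] at hx'
    exact hT.mvNEquiv hx'
  -- So far `ψ₀ ∘ θ` matches `ψ` only up to equivalence; conjugating `ψ₀` makes the match exact
  -- without changing any class.
  obtain ⟨u, hu⟩ := exists_conj (ψ₀.comp θ) ψ hu
  refine ⟨conj ψ₀ u, fun x => hu x, fun i => ⟨c i, hc i, ?_⟩⟩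
  refine (hψ₀ i 0).of_mvNEquiv ((isMatrixUnits (conj ψ₀ u)).isIdempotentElem i 0)
    ⟨ψ₀ (unit F i 0 0) * ↑u⁻¹, u, by simp, rfl⟩

end Linked

end MatAlg

/-! ### The back-and-forth construction -/

/-- A matricial algebra mapping to both `S` and `T` compatibly with `f`. -/
structure LinkedPair (F : Type u) [Semifield F] {S T : Type v} [Semiring S] [Algebra F S]
    [Semiring T] [Algebra F T] (f : VMonoid S ≃+ VMonoid T) where
  r : ℕ
  n : Fin r → ℕ
  fst : MatAlg F n →ₐ[F] S
  snd : MatAlg F n →ₐ[F] T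
  linked : MatAlg.Linked f fst snd

namespace LinkedPair

variable {F : Type u} [Semifield F] {S T : Type v} [Semiring S] [Algebra F S] [Semiring T]
  [Algebra F T] {f : VMonoid S ≃+ VMonoid T}

/-- The part of the graph of an isomorphism determined by a linked pair. -/
def graph (p : LinkedPair F f) : Subalgebra F (S × T) := (p.fst.prod p.snd).range

theorem mem_graph {p : LinkedPair F f} {z : S × T} :
    z ∈ p.graph ↔ ∃ x, p.fst x = z.1 ∧ p.snd x = z.2 := by
  simp [graph, Prod.ext_iff]

/-- The starting pair is `F` itself, as one block of size one, with its structure maps; `hf` says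
exactly that it is linked. -/
theorem nonempty
    (hf : f (VMonoid.mk (FGProjRight.regular S)) = VMonoid.mk (FGProjRight.regular T)) :
    Nonempty (LinkedPair F f) := by
  have h1 (B : Type v) [Semiring B] : IsMatrixUnits (m := fun _ : Fin 1 => 0)
      (fun _ _ _ => (1 : B)) :=
    ⟨fun _ _ _ _ => one_mul 1, fun _ _ l s _ h => absurd (Subsingleton.elim (α := Fin 1) l s) h,
      fun i j h => absurd (Subsingleton.elim i j) h, by simp⟩
  refine ⟨⟨1, fun _ => 0, (h1 S).lift F, (h1 T).lift F, fun i => ⟨VMonoid.mk (FGProjRight.regular S), ?_, ?_⟩⟩⟩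
  · rw [(h1 S).lift_unit]
    exact VMonoid.IsClassOf.one
  · rw [(h1 T).lift_unit, hf]
    exact VMonoid.IsClassOf.one

/-- One round: enlarge on the `S` side to cover `C`, transport to `T`, enlarge there to cover `D`,
and transport back along `f.symm`. -/
theorem exists_extension
    (hf : f (VMonoid.mk (FGProjRight.regular S)) = VMonoid.mk (FGProjRight.regular T))
    {C : Set S} {D : Set T}
    (hC : ∀ {r : ℕ} {n : Fin r → ℕ} (φ : MatAlg F n →ₐ[F] S),
      ∃ (r' : ℕ) (m : Fin r' → ℕ) (ι : MatAlg F m →ₐ[F] S) (φ' : MatAlg F n →ₐ[F] MatAlg F m),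
        (∀ x, ι (φ' x) = φ x) ∧ ∀ s ∈ C, ∃ x, ι x = s)
    (hD : ∀ {r : ℕ} {n : Fin r → ℕ} (φ : MatAlg F n →ₐ[F] T),
      ∃ (r' : ℕ) (m : Fin r' → ℕ) (ι : MatAlg F m →ₐ[F] T) (φ' : MatAlg F n →ₐ[F] MatAlg F m),
        (∀ x, ι (φ' x) = φ x) ∧ ∀ s ∈ D, ∃ x, ι x = s)
    (p : LinkedPair F f) :
    ∃ q : LinkedPair F f, p.graph ≤ q.graph ∧ (∀ s ∈ C, ∃ t, (s, t) ∈ q.graph) ∧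
      ∀ t ∈ D, ∃ s, (s, t) ∈ q.graph := by
  obtain ⟨r₁, m₁, φ₁, θ₁, hθ₁, hC₁⟩ := hC p.fst
  obtain ⟨ψ₁, hψ₁, h₁⟩ := p.linked.exists_extension hf hθ₁
  obtain ⟨r₂, m₂, ψ₂, θ₂, hθ₂, hD₂⟩ := hD ψ₁
  obtain ⟨φ₂, hφ₂, h₂⟩ := h₁.symm.exists_extension ((f.symm_apply_eq).2 hf.symm) hθ₂
  refine ⟨⟨r₂, m₂, φ₂, ψ₂, h₂.symm⟩, fun z hz => ?_, fun s hs => ?_, fun t ht => ?_⟩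
  · obtain ⟨x, h1, h2⟩ := mem_graph.1 hz
    exact mem_graph.2 ⟨θ₂ (θ₁ x), by rw [hφ₂, hθ₁, h1], by rw [hθ₂, hψ₁, h2]⟩
  · obtain ⟨x, rfl⟩ := hC₁ s hs
    exact ⟨ψ₁ x, mem_graph.2 ⟨θ₂ x, hφ₂ x, hθ₂ x⟩⟩
  · obtain ⟨x, rfl⟩ := hD₂ t ht
    exact ⟨φ₂ x, mem_graph.2 ⟨x, rfl, rfl⟩⟩

end LinkedPair

/-- A subalgebra of a product projecting bijectively to both factors is the graph of an
isomorphism. -/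
theorem Subalgebra.nonempty_algEquiv_of_graph {F S T : Type*} [CommSemiring F] [Semiring S]
    [Algebra F S] [Semiring T] [Algebra F T] (G : Subalgebra F (S × T))
    (hS : ∀ s, ∃ t, (s, t) ∈ G) (hT : ∀ t, ∃ s, (s, t) ∈ G)
    (h : ∀ a ∈ G, ∀ b ∈ G, a.1 = b.1 ↔ a.2 = b.2) : Nonempty (S ≃ₐ[F] T) := by
  have h1 : Function.Bijective ((AlgHom.fst F S T).comp G.val) := by
    refine ⟨fun a b hab => Subtype.ext (Prod.ext hab ((h a a.2 b b.2).1 hab)), fun s => ?_⟩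
    obtain ⟨t, ht⟩ := hS s
    exact ⟨⟨_, ht⟩, rfl⟩
  have h2 : Function.Bijective ((AlgHom.snd F S T).comp G.val) := by
    refine ⟨fun a b hab => Subtype.ext (Prod.ext ((h a a.2 b b.2).2 hab) hab), fun t => ?_⟩
    obtain ⟨s, hs⟩ := hT t
    exact ⟨⟨_, hs⟩, rfl⟩
  exact ⟨(AlgEquiv.ofBijective _ h1).symm.trans (AlgEquiv.ofBijective _ h2)⟩

/-- Ultramatricial algebras with isomorphic pointed monoids `V` are isomorphic. -/
theorem IsUltramatricial.nonempty_algEquiv {F : Type u} [Semifield F] {S T : Type v} [Semiring S]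
    [Algebra F S] [Semiring T] [Algebra F T] (hS : IsUltramatricial F S)
    (hT : IsUltramatricial F T) (f : VMonoid S ≃+ VMonoid T)
    (hf : f (VMonoid.mk (FGProjRight.regular S)) = VMonoid.mk (FGProjRight.regular T)) :
    Nonempty (S ≃ₐ[F] T) := by
  obtain ⟨C, hC, hCf⟩ := hS.exists_factor
  obtain ⟨D, hD, hDf⟩ := hT.exists_factor
  obtain ⟨p₀⟩ := LinkedPair.nonempty (F := F) hf
  choose next hnext hnextC hnextD using fun (k : ℕ) (p : LinkedPair F f) =>
    LinkedPair.exists_extension hf (fun φ => hCf φ k) (fun φ => hDf φ k) p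
  let p : ℕ → LinkedPair F f := fun k => Nat.rec p₀ next k
  have hmono : Monotone fun k => (p k).graph := monotone_nat_of_le_succ fun k => hnext k (p k)
  have hmem {z : S × T} : z ∈ ⨆ k, (p k).graph ↔ ∃ k, z ∈ (p k).graph := by
    rw [← SetLike.mem_coe, Subalgebra.coe_iSup_of_directed hmono.directed_le, Set.mem_iUnion]
    rfl
  refine Subalgebra.nonempty_algEquiv_of_graph (⨆ k, (p k).graph) (fun s => ?_) (fun t => ?_)
    fun a ha b hb => ?_
  · obtain ⟨k, hk⟩ := hC s
    obtain ⟨t, ht⟩ := hnextC k (p k) s hk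
    exact ⟨t, hmem.2 ⟨k + 1, ht⟩⟩
  · obtain ⟨k, hk⟩ := hD t
    obtain ⟨s, hs⟩ := hnextD k (p k) t hk
    exact ⟨s, hmem.2 ⟨k + 1, hs⟩⟩
  · obtain ⟨k, hk⟩ := hmem.1 ha
    obtain ⟨l, hl⟩ := hmem.1 hb
    -- Both points lie in the graph at stage `max k l`, where linkedness makes the relation
    -- single-valued in both directions.
    obtain ⟨x, hx1, hx2⟩ := LinkedPair.mem_graph.1 (hmono (le_max_left k l) hk)
    obtain ⟨y, hy1, hy2⟩ := LinkedPair.mem_graph.1 (hmono (le_max_right k l) hl)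
    rw [← hx1, ← hy1, ← hx2, ← hy2]
    exact ⟨(p _).linked.apply_eq_of_apply_eq fun _ _ _ => hS.eq_of_smul_eq,
      (p _).linked.symm.apply_eq_of_apply_eq fun _ _ _ => hT.eq_of_smul_eq⟩

theorem theorem5p11 {F : Type u} [Semifield F]
    {S : Type v} [Semiring S] [Algebra F S] {T : Type v} [Semiring T] [Algebra F T]
    (hS : IsUltramatricial F S) (hT : IsUltramatricial F T) :
    (∃ f : VMonoid S ≃+ VMonoid T,
      f (VMonoid.mk (FGProjRight.regular S)) = VMonoid.mk (FGProjRight.regular T)) ↔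
    Nonempty (S ≃ₐ[F] T) :=
  ⟨fun ⟨f, hf⟩ => hS.nonempty_algEquiv hT f hf,
    fun ⟨e⟩ => ⟨VMonoid.congr e.toRingEquiv, VMonoid.congr_regular e.toRingEquiv⟩⟩
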